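/- Let $n\ge 1$ and let $\mathcal T(n)$ be the set of all spanning trees of the complete graph on the labelled vertex set $[n]$. The tree-distance of $T_1,T_2\in\mathcal T(n)$ with edge sets $E_1,E_2$ is $d(T_1,T_2)=n-1-|E_1\cap E_2|$. An $(n,d)$ tree-code is a set $\mathcal C\subseteq\mathcal T(n)$ such that the minimum of $d(T_1,T_2)$ over distinct $T_1,T_2\in\mathcal C$ equals $d$, and $A(n,d)$ denotes the largest size of an $(n,d)$ tree-code. All bounds below concern integers $1<d\le n-2$. (1) If $d=d(n)=o(n)$, then for all sufficiently large $n$ $$A(n,d)\ \ge\ \Big(\frac{d}{\sqrt e\,n}\Big)^{2d} n^{\,n-d}.$$ Moreover, for all sufficiently large $n$ and all $d\ge 2\sqrt n$, $A(n,d)\ge (4/e)^d\, n^{\,n-2d}$; and if $d=d(n)=n^{1-o(1)}$, then $A(n,d)\ge n^{\,n-d-o(d)}$ as $n\to\infty$. (2) For $\delta\in(0,1)$ put $$c_\delta=(1-\delta)\,\delta^{\frac{\delta}{1-\delta}}\max\Big\{\delta^{\frac{\delta}{1-\delta}},\tfrac12\Big\}.$$ For every fixed $\delta\in(0,1)$ and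 all sufficiently large $n$ (depending on $\delta$), $d=\lfloor \delta n\rfloor$ (so $d=\delta n$ whenever $\delta n$ is an integer) satisfies $$A(n,d)\ \ge\ 2.5\,(c_\delta n)^{\,n-d+1/2}.$$ Moreover $c_\delta\in(0,1)$, $c_\delta$ is strictly decreasing in $\delta\in(0,1)$, and $c_\delta\to1$ as $\delta\to0^+$. (3) If $d=d(n)$ satisfies $n-d=o(n)$, then for all sufficiently large $n$ $$A(n,d)\ \ge\ \Big(\frac{n-d}{2e}\Big)^{n-d}.$$ Moreover, for every fixed integer $k\ge1$, $A(n,d)=\Omega(n^k)$ when $d=n-\frac{(k+1)\ln n}{\ln\ln n}$, rounded up or down to an integer, i.e. for integers $d=d(n)$ with $\big|d-\big(n-\frac{(k+1)\ln n}{\ln\ln n}\big)\big|<1$. -/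

import Mathlib

open Filter Topology Asymptotics

/-- The set of all spanning trees of the complete graph on `n` labelled vertices. -/
def spanningTrees (n : ℕ) : Set (SimpleGraph (Fin n)) :=
  {T | T.IsTree}

/-- The tree-distance `n - 1 - |E(T₁) ∩ E(T₂)|` (a tree has `n - 1` edges, so the natural
subtraction does not truncate on spanning trees). -/
noncomputable def treeDist {n : ℕ} (T₁ T₂ : SimpleGraph (Fin n)) : ℕ :=
  n - 1 - (T₁.edgeSet ∩ T₂.edgeSet).ncard

/-- `d` is the minimum tree-distance between two distinct members of `C`. -/
def HasTreeDist {n : ℕ} (C : Set (SimpleGraph (Fin n))) (d : ℕ) : Prop :=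
  IsLeast {k | ∃ T₁ ∈ C, ∃ T₂ ∈ C, T₁ ≠ T₂ ∧ treeDist T₁ T₂ = k} d

/-- An `(n, d)` tree-code: a set of spanning trees whose tree-distance is `d`. -/
def IsTreeCode (n d : ℕ) (C : Set (SimpleGraph (Fin n))) : Prop :=
  C ⊆ spanningTrees n ∧ HasTreeDist C d

/-- `A(n, d)`, the largest size of an `(n, d)` tree-code. -/
noncomputable def treeCodeMax (n d : ℕ) : ℕ :=
  sSup {m | ∃ C : Set (SimpleGraph (Fin n)), IsTreeCode n d C ∧ C.ncard = m}

/-- The sizes of `(n, d)` tree-codes are bounded, so the supremum above is a maximum as soon as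
there is an `(n, d)` tree-code. -/
theorem bddAbove_treeCode_sizes (n d : ℕ) :
    BddAbove {m | ∃ C : Set (SimpleGraph (Fin n)), IsTreeCode n d C ∧ C.ncard = m} := by
  refine ⟨(Set.univ : Set (SimpleGraph (Fin n))).ncard, ?_⟩
  rintro m ⟨C, -, rfl⟩
  exact Set.ncard_le_ncard (Set.subset_univ C) Set.finite_univ

/-- The constant `c_δ = (1-δ) δ^{δ/(1-δ)} max {δ^{δ/(1-δ)}, 1/2}`. -/
noncomputable def cConst (δ : ℝ) : ℝ :=
  (1 - δ) * δ ^ (δ / (1 - δ)) * max (δ ^ (δ / (1 - δ))) (1 / 2)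

/-!
The bounds are all sphere-covering (Gilbert–Varshamov) bounds: a maximal code of minimum distance
`d` has size at least the number of trees divided by the largest size of a ball of radius `d - 1`.

Both counts come from one formula: a forest on `n` vertices whose `c` components have sizes
`n₁, …, n_c` is contained in exactly `n ^ (c - 2) * ∏ nᵢ` trees (`card_treesAbove_mul_card`).
It is proved by descending induction on `c`. Every tree above the forest `F` has `c - 1` edges
between different components of `F`, so counting pairs of a tree and such an edge gives
`(c - 1) N(F) = ∑ N(F + e)` over all edges `e` between different components; merging components of
sizes `a` and `b` multiplies `∏ nᵢ` by `1 / a + 1 / b`, and summing this over all such edges gives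
`n (c - 1)`. The empty forest gives Cayley's formula.

A tree at distance less than `d` from `T` contains one of the `(n - 1).choose (n - d)` forests made
of `n - d` edges of `T`, and such a forest has `d` components. The product of their sizes is at most
`(n / d) ^ d` by the inequality of the means (`classProd_le_div_pow`) and at most `2 ^ (n - d)`
since `a ≤ 2 ^ (a - 1)` (`classProd_le_two_pow`). This yields the two covering bounds
`pow_mul_le_treeCodeMax_div_pow` and `pow_mul_le_treeCodeMax_two_pow`. So that the minimum distance
is exactly `d`, the maximal code is built around an explicit pair of trees at distance `d`
(`exists_trees_at_dist`); this is where `d ≤ n - 2` enters.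

What remains is to estimate the binomial coefficient `n.choose d`. The crude estimate
`n.choose k ≤ (e n / k) ^ k` gives the bounds for `d = o(n)` and for `n - d = o(n)`, for every
`1 < d ≤ n - 2` in fact. For `d = ⌊δ n⌋` Stirling's formula is needed: the two covering bounds
correspond to the two terms of the maximum in `cConst`, the constant `5 / 2` is slightly below
`√(2π)`, which absorbs the error in Stirling's formula, and rounding is harmless because `cConst` is
decreasing and `d / n ≤ δ`.
-/

/-! ### Component labellings and merging -/

/-- `f` labels every vertex with its component of `F`: two vertices get the same label exactly
when `F` joins them. Labels are vertices, so that merging two components needs no new label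
type. -/
def IsComponentLabelling {V : Type*} (F : SimpleGraph V) (f : V → V) : Prop :=
  ∀ u v, F.Reachable u v ↔ f u = f v

/-- The number of vertices with label `i`. -/
def fibreCard {V : Type*} [Fintype V] [DecidableEq V] (f : V → V) (i : V) : ℕ :=
  (Finset.univ.filter fun x => f x = i).card

/-- The product of the sizes of all classes of a labelling. -/
def classProd {V : Type*} [Fintype V] [DecidableEq V] (f : V → V) : ℕ :=
  ∏ i ∈ Finset.univ.image f, fibreCard f i

/-- The labelling in which the class of `v` is relabelled to join the class of `u`. -/
def mergeLabel {V : Type*} [DecidableEq V] (f : V → V) (u v : V) : V → V :=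
  fun x => if f x = f v then f u else f x

open Classical in
/-- The trees on the vertex set `V` that contain the graph `F`. -/
noncomputable def treesAbove {V : Type*} [Fintype V] (F : SimpleGraph V) :
    Finset (SimpleGraph V) :=
  Finset.univ.filter fun T => T.IsTree ∧ F ≤ T

theorem mem_treesAbove {V : Type*} [Fintype V] {F T : SimpleGraph V} :
    T ∈ treesAbove F ↔ T.IsTree ∧ F ≤ T := by
  simp [treesAbove]

section Labelling

variable {V : Type*} [Fintype V] [DecidableEq V]

theorem fibreCard_pos (f : V → V) (x : V) : 0 < fibreCard f (f x) :=
  Finset.card_pos.2 ⟨x, by simp⟩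

theorem sum_fibreCard (f : V → V) :
    ∑ i ∈ Finset.univ.image f, fibreCard f i = Fintype.card V := by
  rw [← Finset.card_univ, Finset.card_eq_sum_card_image f]
  rfl

theorem isComponentLabelling_mergeLabel {V : Type*} [DecidableEq V] {F : SimpleGraph V}
    {f : V → V}
    (hf : IsComponentLabelling F f) {u v : V} (huv : f u ≠ f v) :
    IsComponentLabelling (F ⊔ SimpleGraph.edge u v) (mergeLabel f u v) := by
  have hne : u ≠ v := fun h => huv (by rw [h])
  have mono : ∀ x y, f x = f y → (F ⊔ SimpleGraph.edge u v).Reachable x y :=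
    fun x y h => ((hf x y).2 h).mono le_sup_left
  have huv' : (F ⊔ SimpleGraph.edge u v).Reachable u v :=
    SimpleGraph.Adj.reachable (by simp [SimpleGraph.edge_adj, hne])
  intro x y
  constructor
  · rintro ⟨p⟩
    induction p with
    | nil => rfl
    | cons h p ih =>
      rename_i a b c
      rw [← ih]
      rcases h with h | h
      · have : f a = f b := (hf a b).1 h.reachable
        simp [mergeLabel, this]
      · rw [SimpleGraph.edge_adj] at h
        rcases h with ⟨⟨rfl, rfl⟩ | ⟨rfl, rfl⟩, -⟩ <;> simp [mergeLabel]
  · intro h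
    unfold mergeLabel at h
    split_ifs at h with hx hy hy
    · exact mono x y (hx.trans hy.symm)
    · exact (mono x v hx).trans (huv'.symm.trans (mono u y h))
    · exact (mono x u h).trans (huv'.trans (mono v y hy.symm))
    · exact mono x y h

theorem image_mergeLabel {f : V → V} {u v : V} (huv : f u ≠ f v) :
    Finset.univ.image (mergeLabel f u v) = (Finset.univ.image f).erase (f v) := by
  ext i
  simp only [Finset.mem_image, Finset.mem_univ, true_and, Finset.mem_erase, mergeLabel]
  constructor
  · rintro ⟨x, rfl⟩
    split_ifs with h
    · exact ⟨huv, u, rfl⟩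
    · exact ⟨h, x, rfl⟩
  · rintro ⟨h, x, rfl⟩
    exact ⟨x, by simp [h]⟩

theorem card_image_mergeLabel {f : V → V} {u v : V} (huv : f u ≠ f v) :
    (Finset.univ.image (mergeLabel f u v)).card + 1 = (Finset.univ.image f).card := by
  rw [image_mergeLabel huv]
  exact Finset.card_erase_add_one (Finset.mem_image_of_mem f (Finset.mem_univ v))

theorem fibreCard_mergeLabel_self {f : V → V} {u v : V} (huv : f u ≠ f v) :
    fibreCard (mergeLabel f u v) (f u) = fibreCard f (f u) + fibreCard f (f v) := by
  unfold fibreCard mergeLabel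
  rw [← Finset.card_union_of_disjoint]
  · congr 1
    ext x
    simp only [Finset.mem_filter, Finset.mem_univ, true_and, Finset.mem_union]
    split_ifs with h <;> simp [h]
  · rw [Finset.disjoint_filter]
    intro x _ h h'
    exact huv (h.symm.trans h')

theorem fibreCard_mergeLabel_of_ne {f : V → V} {u v i : V} (hu : i ≠ f u) (hv : i ≠ f v) :
    fibreCard (mergeLabel f u v) i = fibreCard f i := by
  unfold fibreCard mergeLabel
  congr 1
  ext x
  simp only [Finset.mem_filter, Finset.mem_univ, true_and]
  split_ifs with h
  · simp [h, hu.symm, hv.symm]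
  · rfl

/-- Merging two classes of sizes `a` and `b` multiplies the product of the class sizes by
`(a + b) / (a b) = 1 / a + 1 / b`. -/
theorem classProd_mergeLabel {f : V → V} {u v : V} (huv : f u ≠ f v) :
    (classProd (mergeLabel f u v) : ℚ) =
      classProd f * (1 / (fibreCard f (f u) : ℚ) + 1 / (fibreCard f (f v) : ℚ)) := by
  have hv : f v ∈ Finset.univ.image f := Finset.mem_image_of_mem f (Finset.mem_univ v)
  have hu : f u ∈ (Finset.univ.image f).erase (f v) :=
    Finset.mem_erase.2 ⟨huv, Finset.mem_image_of_mem f (Finset.mem_univ u)⟩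
  have h1 : classProd (mergeLabel f u v) = (fibreCard f (f u) + fibreCard f (f v)) *
      ∏ i ∈ ((Finset.univ.image f).erase (f v)).erase (f u), fibreCard f i := by
    unfold classProd
    rw [image_mergeLabel huv, ← Finset.mul_prod_erase _ _ hu, fibreCard_mergeLabel_self huv]
    congr 1
    refine Finset.prod_congr rfl fun i hi => ?_
    simp only [Finset.mem_erase] at hi
    exact fibreCard_mergeLabel_of_ne hi.1 hi.2.1
  have h2 : classProd f = fibreCard f (f v) * (fibreCard f (f u) *
      ∏ i ∈ ((Finset.univ.image f).erase (f v)).erase (f u), fibreCard f i) := by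
    unfold classProd
    rw [Finset.mul_prod_erase _ _ hu, Finset.mul_prod_erase _ _ hv]
  have pu : (fibreCard f (f u) : ℚ) ≠ 0 := by exact_mod_cast (fibreCard_pos f u).ne'
  have pv : (fibreCard f (f v) : ℚ) ≠ 0 := by exact_mod_cast (fibreCard_pos f v).ne'
  rw [h1, h2]
  push_cast
  field_simp
  ring

theorem sum_one_div_fibreCard (f : V → V) :
    ∑ x, 1 / (fibreCard f (f x) : ℚ) = (Finset.univ.image f).card := by
  rw [Finset.card_eq_sum_ones, Nat.cast_sum, ← Finset.sum_fiberwise_of_maps_to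
    (s := Finset.univ) (t := Finset.univ.image f) (g := f)
    (fun x _ => Finset.mem_image_of_mem f (Finset.mem_univ x))]
  refine Finset.sum_congr rfl fun i hi => ?_
  obtain ⟨y, -, rfl⟩ := Finset.mem_image.1 hi
  have : ∀ x ∈ Finset.univ.filter (fun x => f x = f y),
      1 / (fibreCard f (f x) : ℚ) = 1 / (fibreCard f (f y) : ℚ) := by
    intro x hx
    rw [(Finset.mem_filter.1 hx).2]
  rw [Finset.sum_congr rfl this, Finset.sum_const, nsmul_eq_mul]
  have hp : (fibreCard f (f y) : ℚ) ≠ 0 := by exact_mod_cast (fibreCard_pos f y).ne'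
  change (fibreCard f (f y) : ℚ) * _ = _
  rw [mul_one_div_cancel hp, Nat.cast_one]

theorem sum_crossing_one_div (f : V → V) :
    ∑ u, ∑ v, (if f u ≠ f v then 1 / (fibreCard f (f u) : ℚ) else 0) =
      Fintype.card V * ((Finset.univ.image f).card - 1) := by
  have h : ∀ u, ∑ v, (if f u ≠ f v then 1 / (fibreCard f (f u) : ℚ) else 0) =
      Fintype.card V * (1 / (fibreCard f (f u) : ℚ)) - 1 := by
    intro u
    have hp : (fibreCard f (f u) : ℚ) ≠ 0 := by exact_mod_cast (fibreCard_pos f u).ne'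
    have hs : ∑ v, (if f u = f v then 1 / (fibreCard f (f u) : ℚ) else 0) = 1 := by
      rw [← Finset.sum_filter, Finset.sum_const, nsmul_eq_mul]
      have : (Finset.univ.filter fun v => f u = f v).card = fibreCard f (f u) := by
        simp only [fibreCard, eq_comm]
      rw [this, mul_one_div_cancel hp]
    have ha : ∑ v, (if f u ≠ f v then 1 / (fibreCard f (f u) : ℚ) else 0) +
        ∑ v, (if f u = f v then 1 / (fibreCard f (f u) : ℚ) else 0) =
        Fintype.card V * (1 / (fibreCard f (f u) : ℚ)) := by
      rw [← Finset.sum_add_distrib, ← Finset.card_univ, ← nsmul_eq_mul, ← Finset.sum_const]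
      refine Finset.sum_congr rfl fun v _ => ?_
      split_ifs <;> simp_all
    linarith
  rw [Finset.sum_congr rfl fun u _ => h u, Finset.sum_sub_distrib, ← Finset.mul_sum,
    sum_one_div_fibreCard]
  simp
  ring

/-- Over all ordered pairs of vertices in different classes, the products of the class sizes after
merging the two classes add up to `2 n (c - 1)` times the product before merging, where `n` is the
number of vertices and `c` the number of classes. -/
theorem sum_classProd_mergeLabel (f : V → V) :
    ∑ u, ∑ v, (if f u ≠ f v then (classProd (mergeLabel f u v) : ℚ) else 0) =
      2 * Fintype.card V * ((Finset.univ.image f).card - 1) * classProd f := by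
  have h1 := sum_crossing_one_div f
  have h2 : ∑ u, ∑ v, (if f u ≠ f v then 1 / (fibreCard f (f v) : ℚ) else 0) =
      Fintype.card V * ((Finset.univ.image f).card - 1) := by
    rw [Finset.sum_comm, ← h1]
    simp only [ne_comm]
  have h3 : ∀ u v, (if f u ≠ f v then (classProd (mergeLabel f u v) : ℚ) else 0) =
      classProd f * ((if f u ≠ f v then 1 / (fibreCard f (f u) : ℚ) else 0) +
        (if f u ≠ f v then 1 / (fibreCard f (f v) : ℚ) else 0)) := by
    intro u v
    split_ifs with h
    · exact classProd_mergeLabel h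
    · simp
  simp only [h3, ← Finset.mul_sum, Finset.sum_add_distrib, h1, h2]
  ring

end Labelling

/-! ### Counting the trees that contain a forest -/

section ForestCount

variable {V : Type*} [Fintype V] [DecidableEq V]

open Classical in
theorem card_adj_pairs {V : Type*} [Fintype V] (G : SimpleGraph V) :
    (Finset.univ.filter fun p : V × V => G.Adj p.1 p.2).card = 2 * G.edgeSet.ncard := by
  rw [← SimpleGraph.coe_edgeFinset, Set.ncard_coe_finset, SimpleGraph.two_mul_card_edgeFinset]

theorem ncard_edgeSet_add_one {V : Type*} [Fintype V] {T : SimpleGraph V} (hT : T.IsTree) :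
    T.edgeSet.ncard + 1 = Fintype.card V := by
  classical
  rw [← SimpleGraph.coe_edgeFinset, Set.ncard_coe_finset, hT.card_edgeFinset]

theorem ncard_edgeSet_sup_edge {V : Type*} [Finite V] {F : SimpleGraph V} {u v : V}
    (hne : u ≠ v) (h : ¬ F.Adj u v) :
    (F ⊔ SimpleGraph.edge u v).edgeSet.ncard = F.edgeSet.ncard + 1 := by
  rw [SimpleGraph.edgeSet_sup, SimpleGraph.edgeSet_edge_of_ne hne, Set.union_singleton,
    Set.ncard_insert_of_notMem (by simpa using h)]

/-- Every forest has a component labelling, and its number of components is the number of vertices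
minus the number of edges. -/
theorem exists_componentLabelling (m : ℕ) : ∀ F : SimpleGraph V, F.IsAcyclic →
    F.edgeSet.ncard = m → ∃ f : V → V, IsComponentLabelling F f ∧
      (Finset.univ.image f).card + m = Fintype.card V := by
  induction m with
  | zero =>
    intro F _ h
    have hF : F = ⊥ := by
      rw [Set.ncard_eq_zero] at h
      exact SimpleGraph.edgeSet_eq_empty.1 h
    refine ⟨id, fun u v => ?_, by simp⟩
    subst hF
    simp [SimpleGraph.reachable_bot]
  | succ m ih =>
    intro F hF h
    have hne : F.edgeSet.Nonempty := by
      rw [← Set.ncard_pos]; omega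
    obtain ⟨⟨u, v⟩, he⟩ := hne
    change F.Adj u v at he
    have hbr := SimpleGraph.isAcyclic_iff_forall_adj_isBridge.1 hF he
    rw [SimpleGraph.isBridge_iff] at hbr
    set F' := F.deleteEdges {s(u, v)} with hF'
    have hsup : F' ⊔ SimpleGraph.edge u v = F := by
      ext a b
      simp only [hF', SimpleGraph.sup_adj, SimpleGraph.deleteEdges_adj, Set.mem_singleton_iff,
        SimpleGraph.adj_edge]
      constructor
      · rintro (h | ⟨h, -⟩)
        · exact h.1
        · rw [← SimpleGraph.mem_edgeSet, ← h]
          exact he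
      · intro h
        by_cases hs : s(a, b) = s(u, v)
        · exact Or.inr ⟨hs.symm, h.ne⟩
        · exact Or.inl ⟨h, hs⟩
    have hnadj : ¬ F'.Adj u v := fun h => hbr h.reachable
    have hcard := ncard_edgeSet_sup_edge he.ne hnadj
    rw [hsup, h] at hcard
    obtain ⟨f, hf, hfc⟩ := ih F' (hF.anti (SimpleGraph.deleteEdges_le _)) (by omega)
    have hfuv : f u ≠ f v := fun h => hbr ((hf u v).2 h)
    refine ⟨mergeLabel f u v, ?_, ?_⟩
    · have := isComponentLabelling_mergeLabel hf hfuv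
      rwa [hsup] at this
    · have := card_image_mergeLabel hfuv
      omega

/-- A forest contains every edge of a larger forest between two vertices that it already joins,
since that edge is a bridge of the larger forest. -/
theorem adj_of_label_eq {V : Type*} {F T : SimpleGraph V} {f : V → V}
    (hf : IsComponentLabelling F f) (hT : T.IsAcyclic) (hFT : F ≤ T) {u v : V}
    (h : T.Adj u v) (hl : f u = f v) : F.Adj u v := by
  by_contra hn
  have hbr := SimpleGraph.isAcyclic_iff_forall_adj_isBridge.1 hT h
  rw [SimpleGraph.isBridge_iff] at hbr
  refine hbr (((hf u v).2 hl).mono fun a b hab => ?_)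
  rw [SimpleGraph.deleteEdges_adj]
  refine ⟨hFT hab, fun hs => hn ?_⟩
  rw [← SimpleGraph.mem_edgeSet, ← Set.mem_singleton_iff.1 hs]
  exact hab

open Classical in
/-- A tree containing a forest `F` with `k + 1` components has `k` edges that join different
components of `F`. -/
theorem card_crossing_pairs {F T : SimpleGraph V} {f : V → V} (hf : IsComponentLabelling F f)
    (hT : T.IsTree) (hFT : F ≤ T) {k : ℕ}
    (hk : k + 1 + F.edgeSet.ncard = Fintype.card V) :
    (Finset.univ.filter fun p : V × V => f p.1 ≠ f p.2 ∧ T.Adj p.1 p.2).card = 2 * k := by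
  have h1 := card_adj_pairs T
  have h2 := card_adj_pairs F
  have h3 := ncard_edgeSet_add_one hT
  have hu : (Finset.univ.filter fun p : V × V => T.Adj p.1 p.2) =
      (Finset.univ.filter fun p : V × V => F.Adj p.1 p.2) ∪
      (Finset.univ.filter fun p : V × V => f p.1 ≠ f p.2 ∧ T.Adj p.1 p.2) := by
    ext p
    simp only [Finset.mem_filter, Finset.mem_univ, true_and, Finset.mem_union]
    constructor
    · intro h
      by_cases hl : f p.1 = f p.2
      · exact Or.inl (adj_of_label_eq hf hT.isAcyclic hFT h hl)
      · exact Or.inr ⟨hl, h⟩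
    · rintro (h | h)
      · exact hFT h
      · exact h.2
  have hd : Disjoint (Finset.univ.filter fun p : V × V => F.Adj p.1 p.2)
      (Finset.univ.filter fun p : V × V => f p.1 ≠ f p.2 ∧ T.Adj p.1 p.2) := by
    rw [Finset.disjoint_filter]
    intro p _ h h'
    exact h'.1 ((hf _ _).1 h.reachable)
  rw [hu, Finset.card_union_of_disjoint hd] at h1
  omega

/-- Double counting of the pairs (tree above `F`, oriented edge of it joining two components of
`F`). -/
theorem sum_card_treesAbove_sup_edge {F : SimpleGraph V} {f : V → V}
    (hf : IsComponentLabelling F f) {k : ℕ} (hk : k + 1 + F.edgeSet.ncard = Fintype.card V) :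
    ∑ u, ∑ v, (if f u ≠ f v then (treesAbove (F ⊔ SimpleGraph.edge u v)).card else 0) =
      2 * k * (treesAbove F).card := by
  classical
  have h1 : ∀ p : V × V,
      (if f p.1 ≠ f p.2 then (treesAbove (F ⊔ SimpleGraph.edge p.1 p.2)).card else 0) =
      ∑ T ∈ treesAbove F, (if f p.1 ≠ f p.2 ∧ T.Adj p.1 p.2 then 1 else 0) := by
    intro p
    split_ifs with h
    · rw [← Finset.sum_filter, ← Finset.card_eq_sum_ones]
      congr 1
      ext T
      simp only [mem_treesAbove, Finset.mem_filter, sup_le_iff, SimpleGraph.edge_le_iff]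
      have hne : p.1 ≠ p.2 := fun e => h (by rw [e])
      tauto
    · simp [h]
  rw [← Finset.sum_product', Finset.univ_product_univ,
    Finset.sum_congr rfl fun p _ => h1 p, Finset.sum_comm]
  have h2 : ∀ T ∈ treesAbove F,
      (∑ p : V × V, if f p.1 ≠ f p.2 ∧ T.Adj p.1 p.2 then 1 else 0) = 2 * k := by
    intro T hT
    rw [mem_treesAbove] at hT
    rw [← Finset.sum_filter, ← Finset.card_eq_sum_ones]
    exact card_crossing_pairs hf hT.1 hT.2 hk
  rw [Finset.sum_congr rfl h2, Finset.sum_const, smul_eq_mul, mul_comm]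

/-- The number `N` of trees on `n` vertices containing a forest whose `c` components have sizes
`n₁, …, n_c` is `n ^ (c - 2) * ∏ nᵢ`, here in the subtraction-free form
`N * n = n ^ (c - 1) * ∏ nᵢ`. -/
theorem card_treesAbove_mul_card (k : ℕ) : ∀ (F : SimpleGraph V) (f : V → V), F.IsAcyclic →
    IsComponentLabelling F f → (Finset.univ.image f).card = k + 1 →
    k + 1 + F.edgeSet.ncard = Fintype.card V →
    (treesAbove F).card * Fintype.card V = Fintype.card V ^ k * classProd f := by
  induction k with
  | zero =>
    intro F f hF hf hc _
    obtain ⟨a, ha⟩ := Finset.card_eq_one.1 hc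
    have hfa : ∀ x, f x = a := fun x => by
      have := Finset.mem_image_of_mem f (Finset.mem_univ x)
      rwa [ha, Finset.mem_singleton] at this
    have : Nonempty V := ⟨a⟩
    have hT : F.IsTree :=
      ⟨⟨fun u v => (hf u v).2 ((hfa u).trans (hfa v).symm)⟩, hF⟩
    have htrees : treesAbove F = {F} := by
      ext T
      rw [mem_treesAbove, Finset.mem_singleton]
      constructor
      · rintro ⟨h1, h2⟩
        have := (SimpleGraph.maximal_isAcyclic_iff_isTree.2 hT).le_of_ge h1.isAcyclic h2
        exact le_antisymm this h2
      · rintro rfl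
        exact ⟨hT, le_rfl⟩
    have hp : classProd f = Fintype.card V := by
      rw [← sum_fibreCard f, classProd, ha, Finset.prod_singleton, Finset.sum_singleton]
    rw [htrees, hp]
    simp
  | succ k ih =>
    intro F f hF hf hc he
    have hdc := sum_card_treesAbove_sup_edge hf he
    have hw := sum_classProd_mergeLabel f
    have hstep : ∀ u v, ((if f u ≠ f v then
        (treesAbove (F ⊔ SimpleGraph.edge u v)).card else 0 : ℕ) : ℚ) * Fintype.card V =
        Fintype.card V ^ k *
          (if f u ≠ f v then (classProd (mergeLabel f u v) : ℚ) else 0) := by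
      intro u v
      split_ifs with h
      · have hnr : ¬ F.Reachable u v := fun hr => h ((hf u v).1 hr)
        have hne : u ≠ v := fun e => h (by rw [e])
        have hcard := ncard_edgeSet_sup_edge hne fun ha => hnr ha.reachable
        have himg := card_image_mergeLabel h
        exact_mod_cast ih (F ⊔ SimpleGraph.edge u v) (mergeLabel f u v)
          (hF.sup_edge_of_not_reachable hnr) (isComponentLabelling_mergeLabel hf h)
          (by omega) (by omega)
      · simp
    have hsum : (2 * (k + 1 : ℕ) * (treesAbove F).card : ℚ) * Fintype.card V =
        Fintype.card V ^ k * (2 * Fintype.card V * ((k + 1 + 1 : ℕ) - 1) * classProd f) := by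
      rw [← hc, ← hw, Finset.mul_sum]
      have : (2 * (k + 1 : ℕ) * (treesAbove F).card : ℚ) =
          ∑ u, ∑ v, ((if f u ≠ f v then
            (treesAbove (F ⊔ SimpleGraph.edge u v)).card else 0 : ℕ) : ℚ) := by
        exact_mod_cast hdc.symm
      rw [this, Finset.sum_mul]
      refine Finset.sum_congr rfl fun u _ => ?_
      rw [Finset.sum_mul, Finset.mul_sum]
      exact Finset.sum_congr rfl fun v _ => hstep u v
    have hk : (2 * ((k : ℚ) + 1)) ≠ 0 := by positivity
    have : (2 * ((k : ℚ) + 1)) * ((treesAbove F).card * Fintype.card V) =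
        (2 * ((k : ℚ) + 1)) * (Fintype.card V ^ (k + 1) * classProd f) := by
      push_cast at hsum
      rw [pow_succ]
      linear_combination hsum
    exact_mod_cast mul_left_cancel₀ hk this

/-- Cayley's formula, in the form `N * n = n ^ (n - 1)`. -/
theorem card_treesAbove_bot_mul_card [Nonempty V] :
    (treesAbove (⊥ : SimpleGraph V)).card * Fintype.card V =
      Fintype.card V ^ (Fintype.card V - 1) := by
  have hpos : 0 < Fintype.card V := Fintype.card_pos
  have hprod : classProd (id : V → V) = 1 := by
    refine Finset.prod_eq_one fun i _ => ?_
    simp [fibreCard, Finset.filter_eq']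
  have := card_treesAbove_mul_card (Fintype.card V - 1) (⊥ : SimpleGraph V) id
    SimpleGraph.isAcyclic_bot (fun u v => by simp [SimpleGraph.reachable_bot])
    (by rw [Finset.image_id, Finset.card_univ]; omega) (by simp; omega)
  rw [this, hprod, mul_one]

end ForestCount

/-! ### Bounds on the product of the component sizes -/

section ClassProdBounds

variable {V : Type*} [Fintype V] [DecidableEq V]

/-- The inequality of arithmetic and geometric means for the class sizes. -/
theorem classProd_le_div_pow (f : V → V) {d : ℕ} (hd : 0 < d)
    (hf : (Finset.univ.image f).card = d) :
    (classProd f : ℝ) ≤ ((Fintype.card V : ℝ) / d) ^ d := by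
  have h := Real.geom_mean_le_arith_mean (Finset.univ.image f) (fun _ => 1)
    (fun i => (fibreCard f i : ℝ)) (by simp) (by simp [hf, hd]) (by simp)
  have hs : ∑ i ∈ Finset.univ.image f, (fibreCard f i : ℝ) = Fintype.card V := by
    exact_mod_cast sum_fibreCard f
  have hp : ∏ i ∈ Finset.univ.image f, (fibreCard f i : ℝ) = classProd f := by
    simp [classProd]
  simp only [Real.rpow_one, one_mul, hs, hp, Finset.sum_const, hf, nsmul_eq_mul, mul_one] at h
  calc (classProd f : ℝ) = ((classProd f : ℝ) ^ ((d : ℝ)⁻¹)) ^ d :=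
        (Real.rpow_inv_natCast_pow (by positivity) hd.ne').symm
    _ ≤ _ := pow_le_pow_left₀ (by positivity) h d

theorem classProd_le_two_pow (f : V → V) {d : ℕ} (hf : (Finset.univ.image f).card = d) :
    classProd f ≤ 2 ^ (Fintype.card V - d) := by
  have hpos : ∀ i ∈ Finset.univ.image f, 1 ≤ fibreCard f i := by
    intro i hi
    obtain ⟨x, -, rfl⟩ := Finset.mem_image.1 hi
    exact fibreCard_pos f x
  have hle : classProd f ≤ ∏ i ∈ Finset.univ.image f, 2 ^ (fibreCard f i - 1) := by
    refine Finset.prod_le_prod' fun i hi => ?_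
    have := (fibreCard f i - 1).lt_two_pow_self
    have := hpos i hi
    omega
  have hs : ∑ i ∈ Finset.univ.image f, (fibreCard f i - 1) + d = Fintype.card V := by
    rw [← hf, Finset.card_eq_sum_ones, ← Finset.sum_add_distrib, ← sum_fibreCard f]
    exact Finset.sum_congr rfl fun i hi => Nat.sub_add_cancel (hpos i hi)
  rw [Finset.prod_pow_eq_pow_sum] at hle
  rwa [← hs, Nat.add_sub_cancel]

end ClassProdBounds

/-! ### Two trees at a prescribed distance -/

section ParentGraph

variable {n : ℕ}

/-- The graph joining every vertex `i ≠ 0` to its parent `p i`. -/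
def parentGraph (p : Fin n → Fin n) : SimpleGraph (Fin n) :=
  SimpleGraph.fromEdgeSet ((fun i => s(i, p i)) '' {i | 0 < i.val})

theorem edgeSet_parentGraph {p : Fin n → Fin n} (hp : ∀ i, 0 < i.val → (p i).val < i.val) :
    (parentGraph p).edgeSet = (fun i => s(i, p i)) '' {i | 0 < i.val} := by
  rw [parentGraph, SimpleGraph.edgeSet_fromEdgeSet, sdiff_eq_left, Set.disjoint_left]
  rintro _ ⟨i, hi, rfl⟩ h
  have := hp i hi
  have h' : i = p i := by simpa using h
  rw [← h'] at this
  exact lt_irrefl _ this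

/-- An edge determines its child vertex, the larger end. -/
theorem eq_and_parent_eq {p q : Fin n → Fin n} (hp : ∀ i, 0 < i.val → (p i).val < i.val)
    (hq : ∀ i, 0 < i.val → (q i).val < i.val) {i j : Fin n} (hi : 0 < i.val) (hj : 0 < j.val)
    (h : s(i, p i) = s(j, q j)) : i = j ∧ p i = q j := by
  rcases Sym2.eq_iff.1 h with h | ⟨h1, h2⟩
  · exact h
  · have a := hp i hi
    have b := hq j hj
    rw [h2] at a
    rw [← h1] at b
    omega

theorem ncard_inter_edgeSet_parentGraph {p q : Fin n → Fin n}
    (hp : ∀ i, 0 < i.val → (p i).val < i.val) (hq : ∀ i, 0 < i.val → (q i).val < i.val) :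
    ((parentGraph p).edgeSet ∩ (parentGraph q).edgeSet).ncard =
      {i : Fin n | 0 < i.val ∧ p i = q i}.ncard := by
  have h : (parentGraph p).edgeSet ∩ (parentGraph q).edgeSet =
      (fun i => s(i, p i)) '' {i : Fin n | 0 < i.val ∧ p i = q i} := by
    rw [edgeSet_parentGraph hp, edgeSet_parentGraph hq]
    ext e
    constructor
    · rintro ⟨⟨i, hi, rfl⟩, ⟨j, hj, hij⟩⟩
      obtain ⟨rfl, h2⟩ := eq_and_parent_eq hp hq hi hj hij.symm
      exact ⟨i, ⟨hi, h2⟩, rfl⟩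
    · rintro ⟨i, ⟨hi, h2⟩, rfl⟩
      exact ⟨⟨i, hi, rfl⟩, ⟨i, hi, by simp [h2]⟩⟩
  rw [h]
  refine Set.InjOn.ncard_image fun i hi j hj hij => ?_
  exact (eq_and_parent_eq hp hp hi.1 hj.1 hij).1

theorem ncard_val_mem_Ioc {m : ℕ} (hm : m < n) : {i : Fin n | 0 < i.val ∧ i.val ≤ m}.ncard = m := by
  have h : Fin.val '' {i : Fin n | 0 < i.val ∧ i.val ≤ m} = (Finset.Ioc 0 m : Set ℕ) := by
    ext k
    simp only [Set.mem_image, Set.mem_ofPred_eq, Finset.coe_Ioc, Set.mem_Ioc]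
    constructor
    · rintro ⟨i, hi, rfl⟩
      exact hi
    · intro hk
      exact ⟨⟨k, by omega⟩, hk, rfl⟩
  rw [← Set.ncard_image_of_injective _ Fin.val_injective, h, Set.ncard_coe_finset, Nat.card_Ioc,
    Nat.sub_zero]

theorem isTree_parentGraph {p : Fin n → Fin n} (hn : 0 < n)
    (hp : ∀ i, 0 < i.val → (p i).val < i.val) : (parentGraph p).IsTree := by
  have hroot : ∀ m, ∀ i : Fin n, i.val = m → (parentGraph p).Reachable ⟨0, hn⟩ i := by
    intro m
    induction m using Nat.strong_induction_on with
    | _ m ih =>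
      intro i hi
      by_cases h0 : 0 < i.val
      · have hadj : (parentGraph p).Adj i (p i) := by
          rw [← SimpleGraph.mem_edgeSet, edgeSet_parentGraph hp]
          exact ⟨i, h0, rfl⟩
        exact (ih _ (hi ▸ hp i h0) (p i) rfl).trans hadj.symm.reachable
      · have : i = ⟨0, hn⟩ := Fin.ext (by simpa using h0)
        rw [this]
  rw [SimpleGraph.isTree_iff_connected_and_card]
  refine ⟨(SimpleGraph.connected_iff_exists_forall_reachable _).2
    ⟨⟨0, hn⟩, fun i => hroot _ i rfl⟩, ?_⟩
  have h := ncard_inter_edgeSet_parentGraph hp hp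
  have h2 : {i : Fin n | 0 < i.val ∧ p i = p i} = {i : Fin n | 0 < i.val ∧ i.val ≤ n - 1} := by
    ext i
    simp only [and_true, Set.mem_ofPred_eq]
    omega
  rw [Set.inter_self, h2, ncard_val_mem_Ioc (by omega)] at h
  rw [Nat.card_coe_set_eq, h, Nat.card_fin]
  omega

/-- The star at `0`, and the tree obtained from it by replacing the edges to the last `d` vertices
by a path, are at distance `d`. -/
theorem exists_trees_at_dist {n d : ℕ} (hdn : d + 2 ≤ n) :
    ∃ T₁ T₂ : SimpleGraph (Fin n), T₁.IsTree ∧ T₂.IsTree ∧ treeDist T₁ T₂ = d := by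
  have hn : 0 < n := by omega
  set p : Fin n → Fin n := fun _ => ⟨0, hn⟩ with hpdef
  set q : Fin n → Fin n := fun i => if i.val ≤ n - 1 - d then ⟨0, hn⟩ else ⟨i.val - 1, by omega⟩
    with hqdef
  have hp : ∀ i, 0 < i.val → (p i).val < i.val := fun i hi => hi
  have hq : ∀ i, 0 < i.val → (q i).val < i.val := by
    intro i hi
    simp only [hqdef]
    split_ifs
    · exact hi
    · simp only
      omega
  refine ⟨parentGraph p, parentGraph q, isTree_parentGraph hn hp, isTree_parentGraph hn hq, ?_⟩
  have h : {i : Fin n | 0 < i.val ∧ p i = q i} =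
      {i : Fin n | 0 < i.val ∧ i.val ≤ n - 1 - d} := by
    ext i
    simp only [hpdef, hqdef, Set.mem_ofPred_eq]
    refine and_congr_right fun _ => ?_
    split_ifs with hi
    · simp [hi]
    · simp only [Fin.mk.injEq, hi, iff_false]
      omega
  rw [treeDist, ncard_inter_edgeSet_parentGraph hp hq, h, ncard_val_mem_Ioc (by omega)]
  omega

end ParentGraph

/-! ### The sphere-covering bound -/

section TreeCodes

variable {n d : ℕ}

theorem treeDist_comm (T₁ T₂ : SimpleGraph (Fin n)) : treeDist T₁ T₂ = treeDist T₂ T₁ := by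
  rw [treeDist, treeDist, Set.inter_comm]

theorem treeDist_self {T : SimpleGraph (Fin n)} (hT : T.IsTree) : treeDist T T = 0 := by
  have := ncard_edgeSet_add_one hT
  rw [Fintype.card_fin] at this
  rw [treeDist, Set.inter_self]
  omega

/-- A maximal code of distance at least `d` that contains a fixed pair at distance `d` is an
`(n, d)` tree-code whose balls of radius `d - 1` cover all trees. -/
theorem exists_covering_treeCode (hd : 1 < d) (hdn : d + 2 ≤ n) :
    ∃ C : Set (SimpleGraph (Fin n)), IsTreeCode n d C ∧
      ∀ T : SimpleGraph (Fin n), T.IsTree → ∃ c ∈ C, treeDist c T < d := by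
  obtain ⟨T₁, T₂, h1, h2, h12⟩ := exists_trees_at_dist hdn
  let good : Set (Set (SimpleGraph (Fin n))) :=
    {C | C ⊆ spanningTrees n ∧ ∀ a ∈ C, ∀ b ∈ C, a ≠ b → d ≤ treeDist a b}
  have hgood : ({T₁, T₂} : Set (SimpleGraph (Fin n))) ∈ good := by
    refine ⟨?_, ?_⟩
    · rintro T (rfl | rfl)
      · exact h1
      · exact h2
    · rintro a (rfl | rfl) b (rfl | rfl) hab
      · exact absurd rfl hab
      · exact h12.ge
      · rw [treeDist_comm]
        exact h12.ge
      · exact absurd rfl hab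
  obtain ⟨C, hle, hmax⟩ := (Set.toFinite good).exists_le_maximal hgood
  have hC1 : T₁ ∈ C := hle (by simp)
  have hC2 : T₂ ∈ C := hle (by simp)
  have hne : T₁ ≠ T₂ := by
    rintro rfl
    rw [treeDist_self h1] at h12
    omega
  refine ⟨C, ⟨hmax.prop.1, ⟨T₁, hC1, T₂, hC2, hne, h12⟩, ?_⟩, ?_⟩
  · rintro k ⟨a, ha, b, hb, hab, rfl⟩
    exact hmax.prop.2 a ha b hb hab
  · intro T hT
    by_contra! hfar
    have hins : insert T C ∈ good := by
      refine ⟨Set.insert_subset hT hmax.prop.1, ?_⟩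
      rintro a (rfl | ha) b (rfl | hb) hab
      · exact absurd rfl hab
      · rw [treeDist_comm]
        exact hfar b hb
      · exact hfar a ha
      · exact hmax.prop.2 a ha b hb hab
    have hTC : T ∈ C := hmax.le_of_ge hins (Set.subset_insert T C) (Set.mem_insert T C)
    have := hfar T hTC
    rw [treeDist_self hT] at this
    omega

theorem ncard_le_treeCodeMax {C : Set (SimpleGraph (Fin n))} (hC : IsTreeCode n d C) :
    C.ncard ≤ treeCodeMax n d :=
  le_csSup (bddAbove_treeCode_sizes n d) ⟨C, hC, rfl⟩

/-- The trees at distance less than `d` from `T`. -/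
noncomputable def treeBall (T : SimpleGraph (Fin n)) (d : ℕ) : Finset (SimpleGraph (Fin n)) :=
  (treesAbove ⊥).filter fun T' => treeDist T T' < d

/-- A forest with `n - d` edges has `d` components, so at most `n ^ (d - 2) * B` trees contain it,
where `B` bounds the product of the component sizes. -/
theorem card_treesAbove_le {B : ℝ} (hd : 1 < d) (hdn : d ≤ n)
    (hB : ∀ f : Fin n → Fin n, (Finset.univ.image f).card = d → (classProd f : ℝ) ≤ B)
    {F : SimpleGraph (Fin n)} (hF : F.IsAcyclic) (hc : F.edgeSet.ncard = n - d) :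
    ((treesAbove F).card : ℝ) ≤ (n : ℝ) ^ (d - 2) * B := by
  obtain ⟨f, hf, hfc⟩ := exists_componentLabelling (n - d) F hF hc
  rw [Fintype.card_fin] at hfc
  have hcount := card_treesAbove_mul_card (d - 1) F f hF hf (by omega)
    (by rw [Fintype.card_fin]; omega)
  rw [Fintype.card_fin, show d - 1 = d - 2 + 1 by omega, pow_succ] at hcount
  have hn : (0 : ℝ) < n := by exact_mod_cast (by omega : 0 < n)
  have hcount' : ((treesAbove F).card : ℝ) * n = (n : ℝ) ^ (d - 2) * n * classProd f := by
    exact_mod_cast hcount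
  have heq : ((treesAbove F).card : ℝ) = (n : ℝ) ^ (d - 2) * classProd f :=
    mul_right_cancel₀ hn.ne' (by linear_combination hcount')
  rw [heq]
  exact mul_le_mul_of_nonneg_left (hB f (by omega)) (by positivity)

/-- Every tree of the ball contains one of the `(n - 1).choose (n - d)` forests formed by `n - d`
edges of the centre. -/
theorem card_treeBall_le {B : ℝ} (hd : 1 < d) (hdn : d ≤ n)
    (hB : ∀ f : Fin n → Fin n, (Finset.univ.image f).card = d → (classProd f : ℝ) ≤ B)
    {T : SimpleGraph (Fin n)} (hT : T.IsTree) :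
    ((treeBall T d).card : ℝ) ≤ (n - 1).choose (n - d) * ((n : ℝ) ^ (d - 2) * B) := by
  classical
  have hcT : T.edgeFinset.card = n - 1 := by
    have := hT.card_edgeFinset
    rw [Fintype.card_fin] at this
    omega
  have hsub : treeBall T d ⊆ (T.edgeFinset.powersetCard (n - d)).biUnion
      fun s => treesAbove (SimpleGraph.fromEdgeSet (s : Set (Sym2 (Fin n)))) := by
    intro T' hT'
    rw [treeBall, Finset.mem_filter, mem_treesAbove] at hT'
    obtain ⟨⟨hT', -⟩, hdist⟩ := hT'
    have hle : n - d ≤ (T.edgeFinset ∩ T'.edgeFinset).card := by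
      rw [treeDist, ← SimpleGraph.coe_edgeFinset, ← SimpleGraph.coe_edgeFinset,
        ← Finset.coe_inter, Set.ncard_coe_finset] at hdist
      omega
    obtain ⟨s, hs, hsc⟩ := Finset.exists_subset_card_eq hle
    rw [Finset.mem_biUnion]
    refine ⟨s, Finset.mem_powersetCard.2 ⟨hs.trans Finset.inter_subset_left, hsc⟩, ?_⟩
    rw [mem_treesAbove]
    refine ⟨hT', ?_⟩
    rw [← SimpleGraph.fromEdgeSet_edgeSet T']
    refine SimpleGraph.fromEdgeSet_mono fun e he => ?_
    exact SimpleGraph.mem_edgeFinset.1 (Finset.mem_of_mem_inter_right (hs he))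
  have hbound : ∀ s ∈ T.edgeFinset.powersetCard (n - d),
      ((treesAbove (SimpleGraph.fromEdgeSet (s : Set (Sym2 (Fin n))))).card : ℝ) ≤
        (n : ℝ) ^ (d - 2) * B := by
    intro s hs
    obtain ⟨hsT, hsc⟩ := Finset.mem_powersetCard.1 hs
    have hsE : (s : Set (Sym2 (Fin n))) ⊆ T.edgeSet :=
      fun e he => SimpleGraph.mem_edgeFinset.1 (hsT he)
    refine card_treesAbove_le hd hdn hB (hT.isAcyclic.anti ?_) ?_
    · rw [← SimpleGraph.fromEdgeSet_edgeSet T]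
      exact SimpleGraph.fromEdgeSet_mono hsE
    · rw [SimpleGraph.edgeSet_fromEdgeSet, sdiff_eq_left.2, Set.ncard_coe_finset, hsc]
      exact Set.disjoint_left.2 fun e he => T.not_isDiag_of_mem_edgeSet (hsE he)
  calc ((treeBall T d).card : ℝ)
      ≤ ∑ s ∈ T.edgeFinset.powersetCard (n - d),
          ((treesAbove (SimpleGraph.fromEdgeSet (s : Set (Sym2 (Fin n))))).card : ℝ) := by
        exact_mod_cast (Finset.card_le_card hsub).trans Finset.card_biUnion_le
    _ ≤ ∑ s ∈ T.edgeFinset.powersetCard (n - d), (n : ℝ) ^ (d - 2) * B :=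
        Finset.sum_le_sum hbound
    _ = _ := by rw [Finset.sum_const, Finset.card_powersetCard, hcT, nsmul_eq_mul]

/-- The sphere-covering bound, with `B` a bound for the product of the component sizes of a forest
with `d` components. -/
theorem pow_mul_le_treeCodeMax {B : ℝ} (hd : 1 < d) (hdn : d + 2 ≤ n)
    (hB : ∀ f : Fin n → Fin n, (Finset.univ.image f).card = d → (classProd f : ℝ) ≤ B) :
    (n : ℝ) ^ (n - d) * n ≤ treeCodeMax n d * (d * n.choose d * B) := by
  classical
  have hn : (0 : ℝ) < n := by exact_mod_cast (by omega : 0 < n)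
  have : Nonempty (Fin n) := ⟨⟨0, by omega⟩⟩
  obtain ⟨C, hC, hcov⟩ := exists_covering_treeCode hd hdn
  have hsub : treesAbove (⊥ : SimpleGraph (Fin n)) ⊆
      C.toFinset.biUnion fun c => treeBall c d := by
    intro T hT
    obtain ⟨c, hc, hcd⟩ := hcov T (mem_treesAbove.1 hT).1
    rw [Finset.mem_biUnion]
    exact ⟨c, Set.mem_toFinset.2 hc, Finset.mem_filter.2 ⟨hT, hcd⟩⟩
  have hX0 : 0 ≤ (n - 1).choose (n - d) * ((n : ℝ) ^ (d - 2) * B) := by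
    obtain ⟨c, hc, -⟩ := hC.2.1
    exact (Nat.cast_nonneg _).trans (card_treeBall_le hd (by omega) hB (hC.1 hc))
  have hcount : ((treesAbove (⊥ : SimpleGraph (Fin n))).card : ℝ) ≤
      treeCodeMax n d * ((n - 1).choose (n - d) * ((n : ℝ) ^ (d - 2) * B)) := by
    calc ((treesAbove (⊥ : SimpleGraph (Fin n))).card : ℝ)
        ≤ ∑ c ∈ C.toFinset, ((treeBall c d).card : ℝ) := by
          exact_mod_cast (Finset.card_le_card hsub).trans Finset.card_biUnion_le
      _ ≤ ∑ c ∈ C.toFinset, ((n - 1).choose (n - d) * ((n : ℝ) ^ (d - 2) * B)) :=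
          Finset.sum_le_sum fun c hc =>
            card_treeBall_le hd (by omega) hB (hC.1 (Set.mem_toFinset.1 hc))
      _ = C.ncard * ((n - 1).choose (n - d) * ((n : ℝ) ^ (d - 2) * B)) := by
          rw [Finset.sum_const, nsmul_eq_mul, Set.ncard_eq_toFinset_card']
      _ ≤ _ := mul_le_mul_of_nonneg_right (by exact_mod_cast ncard_le_treeCodeMax hC) hX0
  have hcayley : ((treesAbove (⊥ : SimpleGraph (Fin n))).card : ℝ) * n = (n : ℝ) ^ (n - 1) := by
    have := card_treesAbove_bot_mul_card (V := Fin n)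
    rw [Fintype.card_fin] at this
    exact_mod_cast this
  have hchoose : (n : ℝ) * (n - 1).choose (n - d) = d * n.choose d := by
    have h := Nat.add_one_mul_choose_eq (n - 1) (d - 1)
    rw [Nat.sub_add_cancel (by omega), Nat.sub_add_cancel (by omega)] at h
    rw [← Nat.choose_symm_of_eq_add (n := n - 1) (a := d - 1) (b := n - d) (by omega),
      mul_comm (d : ℝ)]
    exact_mod_cast h
  -- Both sides are compared after multiplication by `n ^ (d - 2)`.
  have hpow : (0 : ℝ) < (n : ℝ) ^ (d - 2) := by positivity
  refine le_of_mul_le_mul_right ?_ hpow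
  have e1 : (n : ℝ) ^ (n - d) * n * (n : ℝ) ^ (d - 2) = (n : ℝ) ^ (n - 1) := by
    rw [← pow_succ, ← pow_add]
    congr 1
    omega
  rw [e1, ← hcayley]
  calc ((treesAbove (⊥ : SimpleGraph (Fin n))).card : ℝ) * n
      ≤ treeCodeMax n d * ((n - 1).choose (n - d) * ((n : ℝ) ^ (d - 2) * B)) * n :=
        mul_le_mul_of_nonneg_right hcount hn.le
    _ = treeCodeMax n d * (((n : ℝ) * (n - 1).choose (n - d)) * B) * (n : ℝ) ^ (d - 2) := by ring
    _ = _ := by rw [hchoose]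

theorem pow_mul_le_treeCodeMax_div_pow (hd : 1 < d) (hdn : d + 2 ≤ n) :
    (n : ℝ) ^ (n - d) * n ≤ treeCodeMax n d * (d * n.choose d * ((n : ℝ) / d) ^ d) :=
  pow_mul_le_treeCodeMax hd hdn fun f hf => by
    have := classProd_le_div_pow f (by omega) hf
    rwa [Fintype.card_fin] at this

theorem pow_mul_le_treeCodeMax_two_pow (hd : 1 < d) (hdn : d + 2 ≤ n) :
    (n : ℝ) ^ (n - d) * n ≤ treeCodeMax n d * (d * n.choose d * 2 ^ (n - d)) :=
  pow_mul_le_treeCodeMax hd hdn fun f hf => by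
    have := classProd_le_two_pow f hf
    rw [Fintype.card_fin] at this
    exact_mod_cast this

end TreeCodes

/-! ### Explicit bounds -/

section Bounds

variable {n d : ℕ}

theorem choose_mul_pow_self_le (n k : ℕ) :
    (n.choose k : ℝ) * (k : ℝ) ^ k ≤ (Real.exp 1 * n) ^ k := by
  have h1 : (n.choose k : ℝ) ≤ (n : ℝ) ^ k / k.factorial := Nat.choose_le_pow_div k n
  have h2 : (k : ℝ) ^ k / k.factorial ≤ Real.exp k :=
    Real.pow_div_factorial_le_exp (k : ℝ) (Nat.cast_nonneg k) k
  have hf : (0 : ℝ) < k.factorial := by exact_mod_cast k.factorial_pos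
  calc (n.choose k : ℝ) * (k : ℝ) ^ k ≤ (n : ℝ) ^ k / k.factorial * (k : ℝ) ^ k := by gcongr
    _ = (k : ℝ) ^ k / k.factorial * (n : ℝ) ^ k := by ring
    _ ≤ Real.exp k * (n : ℝ) ^ k := by gcongr
    _ = _ := by rw [mul_pow, ← Real.exp_one_pow]

theorem pow_two_mul_mul_pow_le_treeCodeMax (hd : 1 < d) (hdn : d + 2 ≤ n) :
    ((d : ℝ) / (√(Real.exp 1) * n)) ^ (2 * d) * (n : ℝ) ^ (n - d) ≤ treeCodeMax n d := by
  have h := pow_mul_le_treeCodeMax_div_pow hd hdn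
  have hc := choose_mul_pow_self_le n d
  have hn : (0 : ℝ) < n := by exact_mod_cast (by omega : 0 < n)
  have hd0 : (0 : ℝ) < d := by exact_mod_cast (by omega : 0 < d)
  have hdn' : (d : ℝ) ≤ n := by exact_mod_cast (by omega : d ≤ n)
  have hX : ((d : ℝ) / (√(Real.exp 1) * n)) ^ (2 * d) =
      (d : ℝ) ^ d * (d : ℝ) ^ d / ((Real.exp 1 * n) ^ d * (n : ℝ) ^ d) := by
    rw [pow_mul, div_pow, mul_pow, Real.sq_sqrt (Real.exp_pos 1).le, div_pow, ← mul_pow, ← mul_pow]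
    ring
  rw [hX, div_mul_eq_mul_div, div_le_iff₀ (by positivity)]
  have h2 : (n : ℝ) ^ (n - d) * n * (d : ℝ) ^ d ≤
      treeCodeMax n d * d * n.choose d * (n : ℝ) ^ d := by
    rw [div_pow] at h
    rw [← le_div_iff₀ (by positivity)]
    calc _ ≤ _ := h
      _ = _ := by ring
  refine le_of_mul_le_mul_right ?_ hd0
  calc (d : ℝ) ^ d * (d : ℝ) ^ d * (n : ℝ) ^ (n - d) * d
      ≤ (d : ℝ) ^ d * (d : ℝ) ^ d * (n : ℝ) ^ (n - d) * n := by gcongr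
    _ = (n : ℝ) ^ (n - d) * n * (d : ℝ) ^ d * (d : ℝ) ^ d := by ring
    _ ≤ treeCodeMax n d * d * n.choose d * (n : ℝ) ^ d * (d : ℝ) ^ d := by gcongr
    _ = treeCodeMax n d * d * (n : ℝ) ^ d * (n.choose d * (d : ℝ) ^ d) := by ring
    _ ≤ treeCodeMax n d * d * (n : ℝ) ^ d * (Real.exp 1 * n) ^ d := by gcongr
    _ = _ := by ring

theorem four_div_exp_pow_mul_rpow_le_treeCodeMax (hd : 1 < d) (hdn : d + 2 ≤ n)
    (hs : 2 * √(n : ℝ) ≤ d) :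
    (4 / Real.exp 1) ^ d * (n : ℝ) ^ ((n : ℝ) - 2 * (d : ℝ)) ≤ treeCodeMax n d := by
  refine le_trans ?_ (pow_two_mul_mul_pow_le_treeCodeMax hd hdn)
  have hn : (0 : ℝ) < n := by exact_mod_cast (by omega : 0 < n)
  have hsq : 4 * (n : ℝ) ≤ (d : ℝ) ^ 2 := by
    have := pow_le_pow_left₀ (by positivity) hs 2
    rw [mul_pow, Real.sq_sqrt hn.le] at this
    linarith
  have he : (n : ℝ) ^ ((n : ℝ) - 2 * (d : ℝ)) = (n : ℝ) ^ (n - d) / (n : ℝ) ^ d := by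
    rw [← Real.rpow_natCast, ← Real.rpow_natCast, ← Real.rpow_sub hn, Nat.cast_sub (by omega)]
    congr 1
    ring
  have hb : 4 / Real.exp 1 / n ≤ ((d : ℝ) / (√(Real.exp 1) * n)) ^ 2 := by
    rw [div_pow, mul_pow, Real.sq_sqrt (Real.exp_pos 1).le, div_div,
      div_le_div_iff₀ (by positivity) (by positivity)]
    have : (0 : ℝ) < Real.exp 1 * n := by positivity
    nlinarith
  calc (4 / Real.exp 1) ^ d * (n : ℝ) ^ ((n : ℝ) - 2 * (d : ℝ))
      = (4 / Real.exp 1 / n) ^ d * (n : ℝ) ^ (n - d) := by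
        rw [he, div_pow _ (n : ℝ)]
        ring
    _ ≤ (((d : ℝ) / (√(Real.exp 1) * n)) ^ 2) ^ d * (n : ℝ) ^ (n - d) := by gcongr
    _ = _ := by rw [pow_mul]

/-- For `d = n ^ (1 - ε)`, the factor `(d / (√e n)) ^ (2 d)` equals
`n ^ (-(2 ε + 1 / log n) d)`. -/
theorem rpow_sub_mul_le_treeCodeMax {ε : ℝ} (hd : 1 < d) (hdn : d + 2 ≤ n)
    (hε : (d : ℝ) = (n : ℝ) ^ (1 - ε)) :
    (n : ℝ) ^ ((n : ℝ) - d - (2 * ε + 1 / Real.log n) * d) ≤ treeCodeMax n d := by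
  refine le_trans (le_of_eq ?_) (pow_two_mul_mul_pow_le_treeCodeMax hd hdn)
  have hn1 : (1 : ℝ) < n := by exact_mod_cast (by omega : 1 < n)
  have hn : (0 : ℝ) < n := by linarith
  have hlog : Real.log n ≠ 0 := (Real.log_pos hn1).ne'
  have hq : (d : ℝ) / (√(Real.exp 1) * n) = Real.exp (-ε * Real.log n - 1 / 2) := by
    rw [hε, Real.rpow_def_of_pos hn, ← Real.exp_half]
    nth_rewrite 2 [← Real.exp_log hn]
    rw [← Real.exp_add, ← Real.exp_sub]
    congr 1
    ring
  rw [hq, ← Real.rpow_natCast (n : ℝ) (n - d), Nat.cast_sub (by omega), Real.rpow_def_of_pos hn,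
    Real.rpow_def_of_pos hn, ← Real.exp_nat_mul, ← Real.exp_add]
  congr 1
  push_cast
  field_simp
  ring

theorem div_two_exp_pow_le_treeCodeMax (hd : 1 < d) (hdn : d + 2 ≤ n) :
    (((n : ℝ) - d) / (2 * Real.exp 1)) ^ (n - d) ≤ treeCodeMax n d := by
  have h := pow_mul_le_treeCodeMax_two_pow hd hdn
  have hc := choose_mul_pow_self_le n (n - d)
  rw [Nat.choose_symm (by omega)] at hc
  have hn : (0 : ℝ) < n := by exact_mod_cast (by omega : 0 < n)
  have hd0 : (0 : ℝ) < d := by exact_mod_cast (by omega : 0 < d)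
  have hdn' : (d : ℝ) ≤ n := by exact_mod_cast (by omega : d ≤ n)
  rw [← Nat.cast_sub (by omega), div_pow, div_le_iff₀ (by positivity)]
  have hP : (0 : ℝ) < (n : ℝ) ^ (n - d) * d := by positivity
  refine le_of_mul_le_mul_right ?_ hP
  calc ((n - d : ℕ) : ℝ) ^ (n - d) * ((n : ℝ) ^ (n - d) * d)
      ≤ ((n - d : ℕ) : ℝ) ^ (n - d) * ((n : ℝ) ^ (n - d) * n) := by gcongr
    _ ≤ ((n - d : ℕ) : ℝ) ^ (n - d) * (treeCodeMax n d * (d * n.choose d * 2 ^ (n - d))) := by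
        gcongr
    _ = treeCodeMax n d * d * 2 ^ (n - d) * (n.choose d * ((n - d : ℕ) : ℝ) ^ (n - d)) := by ring
    _ ≤ treeCodeMax n d * d * 2 ^ (n - d) * (Real.exp 1 * n) ^ (n - d) := by gcongr
    _ = _ := by rw [mul_pow, mul_pow]; ring

end Bounds

/-! ### The bound in Stirling form -/

section Stirling

/-- Stirling's formula with relative error `√(2π) / 2.5 - 1 > 0`. -/
theorem eventually_factorial_le :
    ∀ᶠ n : ℕ in atTop, (n.factorial : ℝ) * (5 / 2) ≤
      √(2 * Real.pi) * (√(2 * Real.pi * n) * (n / Real.exp 1) ^ n) := by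
  have hK : 5 / 2 / √(2 * Real.pi) < 1 := by
    rw [div_lt_one (by positivity), Real.lt_sqrt (by norm_num)]
    nlinarith [Real.pi_gt_d2]
  have hlim := Stirling.tendsto_stirlingSeq_sqrt_pi.mul_const (5 / 2 / √(2 * Real.pi))
  have hlt : √Real.pi * (5 / 2 / √(2 * Real.pi)) < √Real.pi :=
    mul_lt_of_lt_one_right (by positivity) hK
  filter_upwards [hlim.eventually_lt_const hlt, eventually_gt_atTop 0] with n hn hpos
  have hn0 : (0 : ℝ) < n := by exact_mod_cast hpos
  rw [Stirling.stirlingSeq, div_mul_div_comm, div_lt_iff₀ (by positivity)] at hn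
  refine hn.le.trans (le_of_eq ?_)
  have : √(2 * Real.pi * n) = √Real.pi * √(2 * n) := by
    rw [← Real.sqrt_mul Real.pi_pos.le]
    congr 1
    ring
  rw [this]
  ring

theorem choose_mul_le_of_factorial_le {d m : ℕ}
    (h : ((d + m).factorial : ℝ) * (5 / 2) ≤ √(2 * Real.pi) *
      (√(2 * Real.pi * (d + m : ℕ)) * ((d + m : ℕ) / Real.exp 1) ^ (d + m))) :
    ((d + m).choose d : ℝ) * (5 / 2 * (√d * √m) * ((d : ℝ) ^ d * (m : ℝ) ^ m)) ≤
      √(d + m : ℕ) * ((d + m : ℕ) : ℝ) ^ (d + m) := by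
  have hd := Stirling.le_factorial_stirling d
  have hm := Stirling.le_factorial_stirling m
  have hch : ((d + m).choose d : ℝ) * d.factorial * m.factorial = (d + m).factorial := by
    have := Nat.choose_mul_factorial_mul_factorial (Nat.le_add_right d m)
    rw [Nat.add_sub_cancel_left] at this
    exact_mod_cast this
  have hpi : (0 : ℝ) < 2 * Real.pi := by positivity
  rw [Real.sqrt_mul hpi.le, div_pow] at hd hm h
  have he : (0 : ℝ) < Real.exp 1 := Real.exp_pos 1
  have key : ((d + m).choose d : ℝ) *
      ((√(2 * Real.pi) * √d * ((d : ℝ) ^ d / Real.exp 1 ^ d)) *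
        (√(2 * Real.pi) * √m * ((m : ℝ) ^ m / Real.exp 1 ^ m))) * (5 / 2) ≤
      √(2 * Real.pi) * (√(2 * Real.pi) * √(d + m : ℕ) *
        (((d + m : ℕ) : ℝ) ^ (d + m) / Real.exp 1 ^ (d + m))) := by
    refine le_trans ?_ h
    rw [← hch, mul_assoc (((d + m).choose d : ℝ)) (d.factorial : ℝ)]
    gcongr
  have hP : 0 < √(2 * Real.pi) * √(2 * Real.pi) / Real.exp 1 ^ (d + m) := by positivity
  refine le_of_mul_le_mul_left ?_ hP
  calc _ = _ := ?_
    _ ≤ _ := key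
    _ = _ := ?_
  · rw [pow_add]
    field_simp
  · field_simp

/-- Combination of the sphere-covering bound with Stirling's formula, for either of the two bounds
`B = r ^ (-m)` on the product of the component sizes. -/
theorem stirling_bound_le_of_covering {d m : ℕ} {A B s r : ℝ} (hd : 0 < d) (hm : 0 < m)
    (hA : 0 ≤ A) (hs0 : 0 < s) (hs1 : s ≤ 1) (hr0 : 0 < r) (hr1 : r ≤ 1)
    (hs : s ^ m = ((d : ℝ) / (d + m : ℕ)) ^ d) (hr : r ^ m * B = 1)
    (hcov : ((d + m : ℕ) : ℝ) ^ m * (d + m : ℕ) ≤ A * (d * (d + m).choose d * B))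
    (hch : ((d + m).choose d : ℝ) * (5 / 2 * (√d * √m) * ((d : ℝ) ^ d * (m : ℝ) ^ m)) ≤
      √(d + m : ℕ) * ((d + m : ℕ) : ℝ) ^ (d + m)) :
    5 / 2 * (m * s * r) ^ ((m : ℝ) + 1 / 2) ≤ A := by
  have hd0 : (0 : ℝ) < d := by exact_mod_cast hd
  have hm0 : (0 : ℝ) < m := by exact_mod_cast hm
  set N : ℝ := ((d + m : ℕ) : ℝ) with hN
  have hdN : (d : ℝ) ≤ N := by rw [hN]; exact_mod_cast Nat.le_add_right d m
  have hN0 : 0 < N := hd0.trans_le hdN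
  have hc0 : 0 < m * s * r := by positivity
  have hB0 : 0 < B := by
    have : 0 < r ^ m := by positivity
    nlinarith
  rw [Real.rpow_add hc0, Real.rpow_natCast, ← Real.sqrt_eq_rpow]
  have hsq : √(m * s * r) ≤ √m := by
    refine Real.sqrt_le_sqrt ?_
    calc (m : ℝ) * s * r ≤ m * 1 * 1 := by gcongr
      _ = m := by ring
  have h1 : N ^ m * (N * (5 / 2 * (√d * √m) * ((d : ℝ) ^ d * (m : ℝ) ^ m))) ≤
      N ^ m * (A * d * B * (√N * N ^ d)) := by
    calc N ^ m * (N * (5 / 2 * (√d * √m) * ((d : ℝ) ^ d * (m : ℝ) ^ m)))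
        = (N ^ m * N) * (5 / 2 * (√d * √m) * ((d : ℝ) ^ d * (m : ℝ) ^ m)) := by ring
      _ ≤ (A * (d * (d + m).choose d * B)) *
            (5 / 2 * (√d * √m) * ((d : ℝ) ^ d * (m : ℝ) ^ m)) := by gcongr
      _ = A * d * B * (((d + m).choose d : ℝ) *
            (5 / 2 * (√d * √m) * ((d : ℝ) ^ d * (m : ℝ) ^ m))) := by ring
      _ ≤ A * d * B * (√N * N ^ (d + m)) := by gcongr
      _ = _ := by rw [pow_add]; ring
  have h2 := le_of_mul_le_mul_left h1 (by positivity : 0 < N ^ m)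
  have hdd : √(d : ℝ) * √(d : ℝ) = d := Real.mul_self_sqrt hd0.le
  have hNN : √N * √N = N := Real.mul_self_sqrt hN0.le
  have hsdN : √(d : ℝ) ≤ √N := Real.sqrt_le_sqrt hdN
  -- Dividing `h2` by `√d * √N` and using `√d ≤ √N` removes all square roots but `√m`.
  have h3 : 5 / 2 * √m * ((d : ℝ) ^ d * (m : ℝ) ^ m) ≤ A * B * N ^ d := by
    have hP : 0 < √(d : ℝ) * √N * √(d : ℝ) := by positivity
    refine le_of_mul_le_mul_right ?_ hP
    calc 5 / 2 * √m * ((d : ℝ) ^ d * (m : ℝ) ^ m) * (√(d : ℝ) * √N * √(d : ℝ))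
        ≤ 5 / 2 * √m * ((d : ℝ) ^ d * (m : ℝ) ^ m) * (√N * √N * √(d : ℝ)) := by gcongr
      _ = N * (5 / 2 * (√d * √m) * ((d : ℝ) ^ d * (m : ℝ) ^ m)) := by rw [hNN]; ring
      _ ≤ A * d * B * (√N * N ^ d) := h2
      _ = A * (√(d : ℝ) * √(d : ℝ)) * B * (√N * N ^ d) := by rw [hdd]
      _ = _ := by ring
  have hP : 0 < B * N ^ d := by positivity
  refine le_of_mul_le_mul_right ?_ hP
  calc 5 / 2 * ((m * s * r) ^ m * √(m * s * r)) * (B * N ^ d)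
      ≤ 5 / 2 * ((m * s * r) ^ m * √m) * (B * N ^ d) := by gcongr
    _ = 5 / 2 * √m * ((s ^ m * N ^ d) * (m : ℝ) ^ m) * (r ^ m * B) := by
        rw [mul_pow, mul_pow]; ring
    _ = 5 / 2 * √m * ((d : ℝ) ^ d * (m : ℝ) ^ m) := by
        rw [hs, hr, div_pow, div_mul_cancel₀ _ (by positivity), mul_one]
    _ ≤ A * B * N ^ d := h3
    _ = _ := by ring

end Stirling

/-! ### The constant `cConst` and linear distances -/

section LinearDistance

theorem cConst_factor_pos {δ : ℝ} (h : 0 < δ) : 0 < δ ^ (δ / (1 - δ)) := Real.rpow_pos_of_pos h _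

theorem cConst_factor_lt_one {δ : ℝ} (h0 : 0 < δ) (h1 : δ < 1) : δ ^ (δ / (1 - δ)) < 1 :=
  Real.rpow_lt_one h0.le h1 (div_pos h0 (by linarith))

theorem cConst_pos {δ : ℝ} (h0 : 0 < δ) (h1 : δ < 1) : 0 < cConst δ := by
  have := cConst_factor_pos h0
  have h : 0 < 1 - δ := by linarith
  unfold cConst
  positivity

theorem cConst_lt_one {δ : ℝ} (h0 : 0 < δ) (h1 : δ < 1) : cConst δ < 1 := by
  have hp := cConst_factor_pos h0
  have hl := cConst_factor_lt_one h0 h1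
  have hm : max (δ ^ (δ / (1 - δ))) (1 / 2) ≤ 1 := max_le hl.le (by norm_num)
  have h : 0 < 1 - δ := by linarith
  unfold cConst
  calc (1 - δ) * δ ^ (δ / (1 - δ)) * max (δ ^ (δ / (1 - δ))) (1 / 2)
      ≤ (1 - δ) * 1 * 1 := by gcongr
    _ < 1 := by linarith

/-- The exponent `δ log δ / (1 - δ)` is minus the slope of the convex function `x log x` between
`δ` and `1`. -/
theorem antitoneOn_cConst_factor :
    AntitoneOn (fun δ : ℝ => δ ^ (δ / (1 - δ))) (Set.Ioo 0 1) := by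
  intro x hx y hy hxy
  simp only
  rw [Real.rpow_def_of_pos hx.1, Real.rpow_def_of_pos hy.1, Real.exp_le_exp]
  have h := Real.convexOn_mul_log.secant_mono (a := 1) (x := x) (y := y) (by simp) hx.1.le hy.1.le
    hx.2.ne hy.2.ne hxy
  simp only [Real.log_one, mul_zero, sub_zero] at h
  have e : ∀ z : ℝ, Real.log z * (z / (1 - z)) = -(z * Real.log z / (z - 1)) := by
    intro z
    rw [← neg_sub z 1, div_neg]
    ring
  rw [e, e]
  linarith

theorem strictAntiOn_cConst : StrictAntiOn cConst (Set.Ioo 0 1) := by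
  intro x hx y hy hxy
  have h := antitoneOn_cConst_factor hx hy hxy.le
  simp only at h
  have hpy := cConst_factor_pos hy.1
  have hpx := cConst_factor_pos hx.1
  have h1 : 0 < 1 - y := by linarith [hy.2]
  have hmax : max (y ^ (y / (1 - y))) (1 / 2) ≤ max (x ^ (x / (1 - x))) (1 / 2) :=
    max_le_max_right _ h
  have h2 : (1 - y) * y ^ (y / (1 - y)) < (1 - x) * x ^ (x / (1 - x)) := by
    calc (1 - y) * y ^ (y / (1 - y)) ≤ (1 - y) * x ^ (x / (1 - x)) := by gcongr
      _ < _ := by gcongr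
  unfold cConst
  refine mul_lt_mul h2 hmax (by positivity) ?_
  have : 0 < 1 - x := by linarith [hx.2]
  positivity

theorem tendsto_cConst : Tendsto cConst (𝓝[>] 0) (𝓝 1) := by
  have hid : Tendsto (fun δ : ℝ => δ) (𝓝[>] 0) (𝓝 0) :=
    tendsto_nhdsWithin_of_tendsto_nhds tendsto_id
  have h1 : Tendsto (fun δ : ℝ => 1 - δ) (𝓝[>] 0) (𝓝 1) := by
    simpa using hid.const_sub 1
  have hlog : Tendsto (fun δ : ℝ => Real.log δ * δ / (1 - δ)) (𝓝[>] 0) (𝓝 0) := by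
    have h := tendsto_log_mul_rpow_nhdsGT_zero zero_lt_one
    simp only [Real.rpow_one] at h
    have h' := h.div h1 one_ne_zero
    rw [zero_div] at h'
    exact h'
  have hs : Tendsto (fun δ : ℝ => δ ^ (δ / (1 - δ))) (𝓝[>] 0) (𝓝 1) := by
    have h := (Real.continuous_exp.tendsto 0).comp hlog
    rw [Real.exp_zero] at h
    refine h.congr' ?_
    filter_upwards [self_mem_nhdsWithin] with δ hδ
    rw [Real.rpow_def_of_pos hδ, Function.comp_apply, mul_div_assoc]
  have hm := hs.max (tendsto_const_nhds (x := (1 / 2 : ℝ)))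
  have := (h1.mul hs).mul hm
  rw [max_eq_left (by norm_num : (1 / 2 : ℝ) ≤ 1), mul_one, mul_one] at this
  exact this

theorem stirling_cConst_le_treeCodeMax {n d : ℕ} (hd : 1 < d) (hdn : d + 2 ≤ n)
    (hf : (n.factorial : ℝ) * (5 / 2) ≤
      √(2 * Real.pi) * (√(2 * Real.pi * n) * (n / Real.exp 1) ^ n)) :
    5 / 2 * (cConst ((d : ℝ) / n) * n) ^ ((n : ℝ) - d + 1 / 2) ≤ treeCodeMax n d := by
  have hcov1 := pow_mul_le_treeCodeMax_div_pow hd hdn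
  have hcov2 := pow_mul_le_treeCodeMax_two_pow hd hdn
  obtain ⟨m, rfl⟩ : ∃ m, n = d + m := ⟨n - d, by omega⟩
  rw [Nat.add_sub_cancel_left] at hcov1 hcov2
  have hch := choose_mul_le_of_factorial_le hf
  have hd0 : (0 : ℝ) < d := by exact_mod_cast (by omega : 0 < d)
  have hm0 : (0 : ℝ) < m := by exact_mod_cast (by omega : 0 < m)
  have hN0 : (0 : ℝ) < (d + m : ℕ) := by exact_mod_cast (by omega : 0 < d + m)
  set t : ℝ := (d : ℝ) / (d + m : ℕ) with ht
  have ht0 : 0 < t := by positivity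
  have ht1 : t < 1 := by
    rw [ht, div_lt_one hN0]
    exact_mod_cast (by omega : d < d + m)
  have h1t : 1 - t = m / (d + m : ℕ) := by
    rw [ht, eq_div_iff hN0.ne', sub_mul, div_mul_cancel₀ _ hN0.ne']
    push_cast
    ring
  have hexp : t / (1 - t) = d / m := by
    rw [h1t, ht]
    field_simp
  have hs : (t ^ (t / (1 - t))) ^ m = t ^ d := by
    rw [hexp, ← Real.rpow_natCast, ← Real.rpow_mul ht0.le, div_mul_cancel₀ _ hm0.ne',
      Real.rpow_natCast]
  have hbase : cConst t * (d + m : ℕ) =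
      m * t ^ (t / (1 - t)) * max (t ^ (t / (1 - t))) (1 / 2) := by
    unfold cConst
    rw [h1t]
    field_simp
  have he : ((d + m : ℕ) : ℝ) - d + 1 / 2 = m + 1 / 2 := by
    push_cast
    ring
  have hp := cConst_factor_pos ht0
  have hl := (cConst_factor_lt_one ht0 ht1).le
  rw [hbase, he]
  rcases max_choice (t ^ (t / (1 - t))) (1 / 2) with hmax | hmax <;> rw [hmax]
  · refine stirling_bound_le_of_covering (by omega) (by omega) (Nat.cast_nonneg _) hp hl hp hl hs
      ?_ hcov1 hch
    rw [hs, ← mul_pow, ht, div_mul_div_cancel₀ hN0.ne', div_self hd0.ne', one_pow]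
  · refine stirling_bound_le_of_covering (by omega) (by omega) (Nat.cast_nonneg _) hp hl
      (by norm_num) (by norm_num) hs ?_ hcov2 hch
    rw [← mul_pow]
    norm_num

theorem eventually_linear_distance {δ : ℝ} (hδ : δ ∈ Set.Ioo (0 : ℝ) 1) :
    ∀ᶠ n : ℕ in atTop, ∀ d : ℕ, d = ⌊δ * (n : ℝ)⌋₊ → 1 < d → d + 2 ≤ n →
      (5 / 2 : ℝ) * (cConst δ * (n : ℝ)) ^ ((n : ℝ) - (d : ℝ) + 1 / 2) ≤ (treeCodeMax n d : ℝ) := by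
  filter_upwards [eventually_factorial_le] with n hf d hdδ hd hdn
  refine le_trans ?_ (stirling_cConst_le_treeCodeMax hd hdn hf)
  have hn : (0 : ℝ) < n := by exact_mod_cast (by omega : 0 < n)
  have hd0 : (0 : ℝ) < d := by exact_mod_cast (by omega : 0 < d)
  have hdn' : (d : ℝ) < n := by exact_mod_cast (by omega : d < n)
  have hle : (d : ℝ) / n ≤ δ := by
    rw [div_le_iff₀ hn, hdδ]
    exact Nat.floor_le (mul_nonneg hδ.1.le hn.le)
  -- Rounding `δ n` down only increases the constant.
  have hc : cConst δ ≤ cConst ((d : ℝ) / n) :=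
    strictAntiOn_cConst.antitoneOn ⟨by positivity, (div_lt_one hn).2 hdn'⟩ hδ hle
  have hc0 := cConst_pos hδ.1 hδ.2
  have hexp : 0 ≤ (n : ℝ) - d + 1 / 2 := by linarith
  gcongr

end LinearDistance

/-! ### Distances close to `n` -/

section NearMaximalDistance

/-- Write `x = log n`, `y = log x` and `m = n - d n`, so that `m` is about `(k + 1) x / y`. The
logarithm of the bound `(m / (2 e)) ^ m` is `m (log m - log 2 - 1)` with
`log m ≥ y - log y - log 2`, hence `(k + 1 - o(1)) x`, which exceeds `k x`. -/
theorem isBigO_treeCodeMax (k : ℕ) (d : ℕ → ℕ)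
    (hd : ∀ᶠ n : ℕ in atTop,
      |(d n : ℝ) - ((n : ℝ) - ((k : ℝ) + 1) * Real.log n / Real.log (Real.log n))| < 1) :
    (fun n : ℕ => (n : ℝ) ^ k) =O[atTop] (fun n : ℕ => (treeCodeMax n (d n) : ℝ)) := by
  have hx : Tendsto (fun n : ℕ => Real.log n) atTop atTop :=
    Real.tendsto_log_atTop.comp tendsto_natCast_atTop_atTop
  have hy : Tendsto (fun n : ℕ => Real.log (Real.log n)) atTop atTop :=
    Real.tendsto_log_atTop.comp hx
  -- `log x = o(x)`, used at `n`, at `log n` and at `log log n`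
  have ho : ∀ c : ℝ, 0 < c → ∀ᶠ z : ℝ in atTop, Real.log z ≤ c * z := by
    intro c hc
    filter_upwards [Real.isLittleO_log_id_atTop.bound hc, eventually_ge_atTop 0] with z hz hz0
    have := (le_abs_self _).trans hz
    rwa [id, Real.norm_of_nonneg hz0] at this
  have h1 := tendsto_natCast_atTop_atTop.eventually (ho (1 / (2 * (k + 1))) (by positivity))
  have h2 := hx.eventually (ho (1 / 2) (by norm_num))
  have h3 := hy.eventually (ho (1 / (2 * (2 * k + 1))) (by positivity))
  refine IsBigO.of_bound 1 ?_
  filter_upwards [hd, h1, h2, h3, eventually_ge_atTop 8, hx.eventually_ge_atTop 1,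
    hy.eventually_ge_atTop (max 1 (6 * (2 * k + 1)))] with n hdn h1 h2 h3 hn8 hx1 hy1
  set x := Real.log n with hxdef
  set y := Real.log x with hydef
  have hn8' : (8 : ℝ) ≤ n := by exact_mod_cast hn8
  have hn : (0 : ℝ) < n := by linarith
  have hx0 : 0 < x := by linarith
  have hy1' : 1 ≤ y := (le_max_left _ _).trans hy1
  have hyk : 6 * (2 * (k : ℝ) + 1) ≤ y := (le_max_right _ _).trans hy1
  have hy0 : 0 < y := by linarith
  have hq2 : 2 ≤ x / y := by
    rw [le_div_iff₀ hy0]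
    linarith
  have hL : ((k : ℝ) + 1) * x / y = (k + 1) * (x / y) := by ring
  rw [hL] at hdn
  obtain ⟨ha, hb⟩ := abs_lt.1 hdn
  have hk0 : (0 : ℝ) ≤ k := Nat.cast_nonneg k
  have hxy : x / y ≤ x := div_le_self hx0.le hy1'
  have hkx : (k + 1) * x ≤ n / 2 := by
    calc ((k : ℝ) + 1) * x ≤ (k + 1) * (1 / (2 * (k + 1)) * n) := by gcongr
      _ = n / 2 := by field_simp
  have hkq : (k + 1) * (x / y) ≤ n / 2 := le_trans (by gcongr) hkx
  have hlow : ((k : ℝ) + 1 / 2) * (x / y) ≤ n - d n := by linarith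
  have hd1 : 1 < d n := by
    have : (1 : ℝ) < d n := by linarith
    exact_mod_cast this
  have hd2 : d n + 2 ≤ n := by
    have : (d n : ℝ) < n := by
      have : 0 < ((k : ℝ) + 1 / 2) * (x / y) := by positivity
      linarith
    have hlt : d n < n := by exact_mod_cast this
    -- `n - d n` exceeds `(k + 1) x / y - 1 ≥ 1`, so it is at least `2`
    have : (d n : ℝ) + 1 < n := by nlinarith
    exact_mod_cast (by exact_mod_cast this : d n + 1 < n)
  have hA := div_two_exp_pow_le_treeCodeMax hd1 hd2
  rw [one_mul, Real.norm_of_nonneg (by positivity), Real.norm_of_nonneg (by positivity)]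
  refine le_trans ?_ hA
  set m : ℝ := (n : ℝ) - d n with hm
  have hcast : ((n - d n : ℕ) : ℝ) = m := by rw [Nat.cast_sub (by omega)]
  have hm0 : 0 < m := lt_of_lt_of_le (by positivity) hlow
  rw [← Real.log_le_log_iff (by positivity) (by positivity), Real.log_pow, Real.log_pow, hcast,
    Real.log_div hm0.ne' (by positivity), Real.log_mul two_ne_zero (Real.exp_pos 1).ne',
    Real.log_exp]
  have hlog2 : Real.log 2 ≤ 1 := by linarith [Real.log_two_lt_d9]
  have hlogm : y - Real.log y - Real.log 2 ≤ Real.log m := by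
    rw [hydef, ← Real.log_div hx0.ne' hy0.ne', ← Real.log_div (by positivity) two_ne_zero]
    refine Real.log_le_log (by positivity) (le_trans ?_ hlow)
    have : 0 ≤ (k : ℝ) * (x / y) := by positivity
    linarith
  have hfrac : Real.log y + 3 ≤ y / (2 * k + 1) := by
    have e1 : 1 / (2 * (2 * (k : ℝ) + 1)) * y = y / (2 * k + 1) / 2 := by field_simp
    have e2 : 6 ≤ y / (2 * (k : ℝ) + 1) := by rwa [le_div_iff₀ (by positivity)]
    rw [e1] at h3
    linarith
  calc (k : ℝ) * x = ((k + 1 / 2) * (x / y)) * (y - y / (2 * k + 1)) := by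
        field_simp
        ring
    _ ≤ m * (y - y / (2 * k + 1)) := by
        have : y / (2 * (k : ℝ) + 1) ≤ y := div_le_self hy0.le (by linarith)
        exact mul_le_mul_of_nonneg_right hlow (by linarith)
    _ ≤ m * (Real.log m - (Real.log 2 + 1)) := by
        refine mul_le_mul_of_nonneg_left ?_ hm0.le
        linarith

end NearMaximalDistance

theorem mainTheorem4 :
    -- (1) linear-order-smaller distances, with the two special ranges
    ((∀ d : ℕ → ℕ, (fun n => (d n : ℝ)) =o[atTop] (fun n : ℕ => (n : ℝ)) →
        ∀ᶠ n : ℕ in atTop, 1 < d n → d n + 2 ≤ n →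
          ((d n : ℝ) / (√(Real.exp 1) * (n : ℝ))) ^ (2 * d n) * (n : ℝ) ^ (n - d n)
            ≤ (treeCodeMax n (d n) : ℝ)) ∧
      (∀ᶠ n : ℕ in atTop, ∀ d : ℕ, 1 < d → d + 2 ≤ n → 2 * √(n : ℝ) ≤ (d : ℝ) →
          (4 / Real.exp 1) ^ d * (n : ℝ) ^ ((n : ℝ) - 2 * (d : ℝ))
            ≤ (treeCodeMax n d : ℝ)) ∧
      (∀ (d : ℕ → ℕ) (ε : ℕ → ℝ), Tendsto ε atTop (𝓝 0) →
        (∀ᶠ n : ℕ in atTop, (d n : ℝ) = (n : ℝ) ^ (1 - ε n)) →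
        ∃ η : ℕ → ℝ, Tendsto η atTop (𝓝 0) ∧
          ∀ᶠ n : ℕ in atTop, 1 < d n → d n + 2 ≤ n →
            (n : ℝ) ^ ((n : ℝ) - (d n : ℝ) - η n * (d n : ℝ))
              ≤ (treeCodeMax n (d n) : ℝ))) ∧
    -- (2) linear distances, and the properties of the constant
    ((∀ δ ∈ Set.Ioo (0 : ℝ) 1, ∀ᶠ n : ℕ in atTop, ∀ d : ℕ, d = ⌊δ * (n : ℝ)⌋₊ →
        1 < d → d + 2 ≤ n →
          (5 / 2 : ℝ) * (cConst δ * (n : ℝ)) ^ ((n : ℝ) - (d : ℝ) + 1 / 2)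
            ≤ (treeCodeMax n d : ℝ)) ∧
      (∀ δ ∈ Set.Ioo (0 : ℝ) 1, cConst δ ∈ Set.Ioo (0 : ℝ) 1) ∧
      StrictAntiOn cConst (Set.Ioo (0 : ℝ) 1) ∧
      Tendsto cConst (𝓝[>] 0) (𝓝 1)) ∧
    -- (3) distances close to `n`
    ((∀ d : ℕ → ℕ, (fun n : ℕ => (n : ℝ) - (d n : ℝ)) =o[atTop] (fun n : ℕ => (n : ℝ)) →
        ∀ᶠ n : ℕ in atTop, 1 < d n → d n + 2 ≤ n →
          (((n : ℝ) - (d n : ℝ)) / (2 * Real.exp 1)) ^ (n - d n)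
            ≤ (treeCodeMax n (d n) : ℝ)) ∧
      (∀ k : ℕ, 1 ≤ k → ∀ d : ℕ → ℕ,
        (∀ᶠ n : ℕ in atTop,
          |(d n : ℝ) - ((n : ℝ) - ((k : ℝ) + 1) * Real.log n / Real.log (Real.log n))| < 1) →
        (fun n : ℕ => (n : ℝ) ^ k) =O[atTop] (fun n : ℕ => (treeCodeMax n (d n) : ℝ)))) := by
  refine ⟨⟨?_, ?_, ?_⟩, ⟨?_, ?_, strictAntiOn_cConst, tendsto_cConst⟩, ?_, ?_⟩
  · exact fun d _ => Eventually.of_forall fun n => pow_two_mul_mul_pow_le_treeCodeMax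
  · exact Eventually.of_forall fun n d => four_div_exp_pow_mul_rpow_le_treeCodeMax
  · intro d ε hε hd
    refine ⟨fun n => 2 * ε n + 1 / Real.log n, ?_, ?_⟩
    · have hlog : Tendsto (fun n : ℕ => 1 / Real.log n) atTop (𝓝 0) := by
        simp only [one_div]
        exact (Real.tendsto_log_atTop.comp tendsto_natCast_atTop_atTop).inv_tendsto_atTop
      simpa using (hε.const_mul 2).add hlog
    · filter_upwards [hd] with n hn h1 h2
      exact rpow_sub_mul_le_treeCodeMax h1 h2 hn
  · exact fun δ hδ => eventually_linear_distance hδ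
  · exact fun δ hδ => ⟨cConst_pos hδ.1 hδ.2, cConst_lt_one hδ.1 hδ.2⟩
  · exact fun d _ => Eventually.of_forall fun n => div_two_exp_pow_le_treeCodeMax
  · exact fun k _ d hd => isBigO_treeCodeMax k d hd
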